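/- Fix $0<p<1$, $q=1-p$, a hop duration $h>0$ and a speed $v>0$. Let $d_F=\log(4/q)/\log 2>2$ and $\delta=1/(d_F-1)\in(0,1)$. The streets of level $l\ge 0$ are the horizontal and vertical unit segments of $[0,1]^2$ whose constant coordinate is $b2^{-(l+1)}$, with $b\in\{1,3,\dots,2^{l+1}-1\}$. Vehicles are placed independently: each one is on any given street of level $l$ with probability $\frac p2\left(\frac q2\right)^l$, at a uniform position, with a fair initial direction of travel. It then moves along its street at constant speed $v$ and is reflected at both ends (billiard motion). The number of vehicles is either exactly $n$ or Poisson distributed with mean $n$ (that is, the vehicles form the hyperfractal Poisson process of total mean $n$). At time $0$ a source vehicle $x$ holds a packet. Holders keep the packet. In each cycle $[mh,(m+1)h]$, $m=0,1,2,\dots$, every vehicle holding the packet at time $mh$ transmits it to its nearest neighbours on its own street at that time, which hold it from time $(m+1)h$. Between streets the packet passes only at intersections: when a vehicle crosses another street at time $t$, the packet can pass between it and the vehicles of that street nearest to it, in either direction; the receiver holds it from time $t+h$. Radio range is unlimited along a street. Let $T_n(x,y)$ be the time at which the packet started by $x$ reaches $y$, and let $T_{\mathrm{broadcast}}=T_{\mathrm{broadcast}}(n)$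 be the expectation of the average of $T_n(x,y)$ over all ordered source-destination pairs $(x,y)$, conditioned on there being at least one vehicle on a horizontal street and at least one on a vertical street (an event whose probability tends to $1$ exponentially fast as $n\to\infty$). Then, for the population of exactly $n$ vehicles as well as for the Poisson population of mean $n$, as $n\to\infty$, $$T_{\mathrm{broadcast}}=O\left(n^{1-\delta}\log n\right),$$ with an implied constant that may depend on $p$, $h$ and $v$. -/

import Mathlib

open Filter MeasureTheory ProbabilityTheory
open scoped ENNReal NNReal

noncomputable section

namespace Hyperfractal

/-! ### The street map -/

/-- A street of the hyperfractal support in the unit square: its orientation (`true` for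
horizontal, `false` for vertical), its level `l`, and the index `k < 2 ^ l` for which the odd
number `b = 2 k + 1` gives its offset `b / 2 ^ (l + 1)`. -/
abbrev Street : Type := Bool × (Σ l : ℕ, Fin (2 ^ l))

/-- `true` if the street is horizontal, `false` if it is vertical. -/
def Street.isHorizontal (s : Street) : Bool := s.1

/-- The level of a street. -/
def Street.level (s : Street) : ℕ := s.2.1

/-- The constant coordinate `b / 2 ^ (l + 1)`, `b` odd, of a street of level `l`. -/
def Street.offset (s : Street) : ℝ := (2 * ((s.2.2 : ℕ) : ℝ) + 1) / 2 ^ (s.2.1 + 1)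

/-- The point of the street `s` with running coordinate `a`. -/
def Street.point (s : Street) (a : ℝ) : ℝ × ℝ :=
  if s.isHorizontal then (a, s.offset) else (s.offset, a)

/-- The street as a segment of length one in the unit square. -/
def Street.segment (s : Street) : Set (ℝ × ℝ) := s.point '' Set.Icc 0 1

/-! ### Dimension and exponent -/

/-- The fractal dimension `log (4 / q) / log 2`, where `q = 1 - p`. -/
def fractalDim (p : ℝ) : ℝ := Real.log (4 / (1 - p)) / Real.log 2

/-- The exponent `δ = 1 / (d_F - 1)`. -/
def delta (p : ℝ) : ℝ := 1 / (fractalDim p - 1)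

/-! ### Vehicles and their motion -/

/-- A vehicle: its street, its position on the street at time `0`, and the sense of its motion at
time `0` (`true` for increasing coordinate). -/
abbrev Vehicle : Type := Street × ℝ × Bool

/-- Billiard reflection of the real line onto `[0, 1]`: the distance to the nearest even integer. -/
def fold (z : ℝ) : ℝ := |z - 2 * (round (z / 2) : ℝ)|

/-- The location at time `t` of a vehicle that moves along its street at constant speed `v` and is
reflected at both ends of the street. -/
def Vehicle.pos (v : ℝ) (c : Vehicle) (t : ℝ) : ℝ × ℝ :=
  c.1.point (fold (c.2.1 + (if c.2.2 then v else -v) * t))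

/-- The law of the street of a vehicle: each single street of level `l` has probability
`(p / 2) (q / 2) ^ l` with `q = 1 - p`. -/
def streetLaw (p : ℝ) : Measure Street :=
  Measure.sum fun s : Street =>
    ENNReal.ofReal (p / 2 * ((1 - p) / 2) ^ s.level) • Measure.dirac s

/-- The law of one vehicle: a street drawn from `streetLaw`, and independently a uniform initial
position in `[0, 1]` and a fair initial sense of motion. -/
def vehicleLaw (p : ℝ) : Measure Vehicle :=
  (streetLaw p).prod ((volume.restrict (Set.Icc (0 : ℝ) 1)).prod
    (uniformOn (Set.univ : Set Bool)))

/-! ### Populations -/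

/-- A finite population of labelled vehicles. -/
abbrev Population : Type := Σ k : ℕ, (Fin k → Vehicle)

/-- The law of a population of exactly `n` independent vehicles. -/
def fixedLaw (p : ℝ) (n : ℕ) : Measure Population :=
  (Measure.pi fun _ : Fin n => vehicleLaw p).map (Sigma.mk n)

/-- The law of the Poisson population of mean size `n`: the size is Poisson distributed with
mean `n`, and given its size the vehicles are independent. -/
def poissonLaw (p : ℝ) (n : ℕ) : Measure Population :=
  Measure.sum fun k : ℕ => (poissonMeasure (n : ℝ≥0)) {k} • fixedLaw p k

/-- The event that the population has a vehicle on a horizontal street and a vehicle on a vertical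
street. -/
def bothDirections : Set Population :=
  {Φ | (∃ i, (Φ.2 i).1.isHorizontal = true) ∧ (∃ j, (Φ.2 j).1.isHorizontal = false)}

/-! ### Broadcast -/

/-- `u` and `w` are nearest neighbours along the street `s` at time `t`: both stand on `s`, and no
vehicle of `s` is strictly between them. -/
def NeighboursOn (v : ℝ) {k : ℕ} (c : Fin k → Vehicle) (t : ℝ) (s : Street) (u w : Fin k) : Prop :=
  (c u).pos v t ∈ s.segment ∧ (c w).pos v t ∈ s.segment ∧
    ∀ i : Fin k, (c i).1 = s → ¬ Sbtw ℝ ((c u).pos v t) ((c i).pos v t) ((c w).pos v t)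

/-- `Holds h v c x y t`: in the broadcast started by `x` at time `0`, the vehicle `y` holds the
packet at time `t`.
* Vehicles keep the packet while they travel (`carry`).
* In each broadcasting cycle, from `m * h` to `(m + 1) * h`, every vehicle that holds the packet at
  the start of the cycle transmits it to its nearest neighbours on its own street (`hop`).
* When a vehicle crosses another street, the packet can be transmitted, in time `h`, between this
  vehicle and the nearest vehicles of the crossed street, in either direction (`turn`). This is the
  only way in which the packet passes from one street to another. -/
inductive Holds (h v : ℝ) {k : ℕ} (c : Fin k → Vehicle) (x : Fin k) : Fin k → ℝ → Prop
  | source : Holds h v c x x 0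
  | carry (u : Fin k) (s t : ℝ) : Holds h v c x u s → s ≤ t → Holds h v c x u t
  | hop (u w : Fin k) (m : ℕ) : Holds h v c x u (m * h) → (c u).1 = (c w).1 →
      NeighboursOn v c (m * h) (c u).1 u w → Holds h v c x w ((m + 1) * h)
  | turn (u w : Fin k) (t : ℝ) : Holds h v c x u t → (c u).1 ≠ (c w).1 →
      (NeighboursOn v c t (c u).1 u w ∨ NeighboursOn v c t (c w).1 u w) →
      Holds h v c x w (t + h)

/-- The time at which the packet of the broadcast started by `x` arrives at `y` (`∞` if never). -/
def arrivalTime (h v : ℝ) {k : ℕ} (c : Fin k → Vehicle) (x y : Fin k) : ℝ≥0∞ :=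
  ⨅ (t : ℝ) (_ : Holds h v c x y t), ENNReal.ofReal t

/-- The average of the arrival times over all source-destination pairs of a population. -/
def pairAverage (h v : ℝ) (Φ : Population) : ℝ≥0∞ :=
  (∑ x : Fin Φ.1, ∑ y : Fin Φ.1, arrivalTime h v Φ.2 x y) / (Φ.1 : ℝ≥0∞) ^ 2

/-- The average broadcast time of a random population with law `P`: the expectation of the average
over all source-destination pairs, given that both directions are populated. -/
def broadcastTime (h v : ℝ) (P : Measure Population) : ℝ≥0∞ :=
  ∫⁻ Φ, pairAverage h v Φ ∂(P[|bothDirections])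

end Hyperfractal

end

/-! The bound obtained is in fact `O(log n)`; since `delta p ≤ 1`, the factor `n ^ (1 - δ)` is at
least 1 and only weakens it. Every vehicle meets every perpendicular street within time `2 / v`.
Hence, once both orientations are populated, at most two turns bring the packet to any populated
street `s`. It then fills `s` in at most as many cycles as `s` has vehicles, and any vehicle
perpendicular to `s` receives it at its next crossing of `s`. If `s` is empty, the destination's own
street is filled instead, in at most `k` cycles for `k` vehicles (`holds_of_fillCount`). The arrival
time is thus a constant plus `h` times the occupation of `s`, with `k` in place of 0. When a street
has weight `w`, this has mean at most `k w + k (1 - w) ^ k`. `exists_level` picks a level where `k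
w` is of order `log k` while `k (1 - w) ^ k` stays bounded. The Poisson case follows by averaging
over `k`, and conditioning costs only a factor 4. -/

namespace Hyperfractal

/-! ### Billiard trajectories and crossings. -/

theorem fold_nonneg (z : ℝ) : 0 ≤ fold z := abs_nonneg _

theorem fold_le_one (z : ℝ) : fold z ≤ 1 := by
  have := abs_sub_round (z / 2)
  unfold fold
  have e : z - 2 * (round (z / 2) : ℝ) = 2 * (z / 2 - round (z / 2)) := by ring
  rw [e, abs_mul, abs_two]
  linarith

theorem fold_two_mul_int_add (m : ℤ) {a : ℝ} (h0 : 0 ≤ a) (h1 : a < 1) :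
    fold (2 * m + a) = a := by
  have e : (2 * (m : ℝ) + a) / 2 = a / 2 + m := by ring
  have r : round (a / 2) = 0 := by
    rw [round_eq_zero_iff]
    constructor <;> linarith
  unfold fold
  rw [e, round_add_intCast, r]
  simp [abs_of_nonneg h0]

/-- A billiard trajectory takes every value in every time window of length `2 / v`. -/
theorem exists_fold_eq {v : ℝ} (hv : 0 < v) (x T : ℝ) (d : Bool) {a : ℝ} (h0 : 0 ≤ a)
    (h1 : a < 1) :
    ∃ t, T ≤ t ∧ t ≤ T + 2 / v ∧ fold (x + (if d then v else -v) * t) = a := by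
  cases d with
  | true =>
    -- The unfolded coordinate passes some `2 m + a` within a run of length 2; `m` gives the first
    -- such point from time `T` on. The other direction mirrors this with a floor.
    set m := ⌈(x + v * T - a) / 2⌉ with hm
    have l1 := Int.le_ceil ((x + v * T - a) / 2)
    have l2 := Int.ceil_lt_add_one ((x + v * T - a) / 2)
    rw [← hm] at l1 l2
    refine ⟨(2 * m + a - x) / v, ?_, ?_, ?_⟩
    · rw [le_div_iff₀ hv]; linarith
    · rw [div_le_iff₀ hv, add_mul, div_mul_cancel₀ _ hv.ne']; linarith
    · have : x + v * ((2 * m + a - x) / v) = 2 * m + a := by field_simp; ring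
      simp only [if_true]
      rw [this, fold_two_mul_int_add m h0 h1]
  | false =>
    set m := ⌊(x - v * T - a) / 2⌋ with hm
    have l1 := Int.floor_le ((x - v * T - a) / 2)
    have l2 := Int.lt_floor_add_one ((x - v * T - a) / 2)
    rw [← hm] at l1 l2
    refine ⟨(x - (2 * m + a)) / v, ?_, ?_, ?_⟩
    · rw [le_div_iff₀ hv]; linarith
    · rw [div_le_iff₀ hv, add_mul, div_mul_cancel₀ _ hv.ne']; linarith
    · have : x + -v * ((x - (2 * m + a)) / v) = 2 * m + a := by field_simp; ring
      simp only [Bool.false_eq_true, if_false]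
      rw [this, fold_two_mul_int_add m h0 h1]

theorem Street.offset_nonneg (s : Street) : 0 ≤ s.offset := by
  unfold Street.offset; positivity

theorem Street.offset_lt_one (s : Street) : s.offset < 1 := by
  unfold Street.offset
  rw [div_lt_one (by positivity), pow_succ]
  have h : ((s.2.2 : ℕ) : ℝ) + 1 ≤ 2 ^ s.2.1 := by exact_mod_cast s.2.2.isLt
  linarith

theorem Vehicle.pos_mem_segment (v : ℝ) (c : Vehicle) (t : ℝ) : c.pos v t ∈ c.1.segment :=
  ⟨_, ⟨fold_nonneg _, fold_le_one _⟩, rfl⟩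

/-- A vehicle crosses every perpendicular street in every time window of length `2 / v`. -/
theorem Vehicle.exists_crossing {v : ℝ} (hv : 0 < v) (c : Vehicle) (s : Street)
    (hs : c.1.isHorizontal ≠ s.isHorizontal) (T : ℝ) :
    ∃ t, T ≤ t ∧ t ≤ T + 2 / v ∧ c.pos v t ∈ s.segment := by
  obtain ⟨t, h1, h2, h3⟩ := exists_fold_eq hv c.2.1 T c.2.2 s.offset_nonneg s.offset_lt_one
  refine ⟨t, h1, h2, c.1.offset, ⟨c.1.offset_nonneg, c.1.offset_lt_one.le⟩, ?_⟩
  unfold Vehicle.pos Street.point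
  rw [h3]
  cases h : s.isHorizontal <;> cases h' : c.1.isHorizontal <;> simp_all

theorem dist_lt_of_sbtw {x y z : ℝ × ℝ} (h : Sbtw ℝ x y z) : dist x y < dist x z := by
  have := h.wbtw.dist_add_dist
  have : 0 < dist y z := dist_pos.2 h.ne_right
  linarith

/-! ### Spread of the packet in a fixed population. -/

section Deterministic

variable {h v : ℝ} {k : ℕ} {c : Fin k → Vehicle} {x : Fin k}

theorem NeighboursOn.symm {t : ℝ} {s : Street} {u w : Fin k} (H : NeighboursOn v c t s u w) :
    NeighboursOn v c t s w u :=
  ⟨H.2.1, H.1, fun i hi hb => H.2.2 i hi hb.symm⟩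

/-- A vehicle standing on a populated street has a nearest neighbour on that street. -/
theorem exists_neighboursOn {t : ℝ} {s : Street} (u : Fin k) (hu : (c u).pos v t ∈ s.segment)
    (hs : ∃ i, (c i).1 = s) : ∃ w, (c w).1 = s ∧ NeighboursOn v c t s u w := by
  classical
  obtain ⟨i, hi⟩ := hs
  -- A vehicle of `s` at least distance works: one strictly between would be closer.
  obtain ⟨w, hw, hmin⟩ := Finset.exists_min_image (Finset.univ.filter fun i => (c i).1 = s)
    (fun i => dist ((c u).pos v t) ((c i).pos v t)) ⟨i, by simp [hi]⟩
  simp only [Finset.mem_filter, Finset.mem_univ, true_and] at hw hmin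
  refine ⟨w, hw, hu, hw ▸ (c w).pos_mem_segment v t, fun j hj hb => ?_⟩
  exact absurd (dist_lt_of_sbtw hb) (not_lt.2 (hmin j hj))

/-- A holder passes the packet to some vehicle of any populated perpendicular street. -/
theorem exists_holds_perp (hv : 0 < v) {u : Fin k} {t : ℝ} (hu : Holds h v c x u t)
    {s : Street} (hs : ∃ i, (c i).1 = s) (hp : (c u).1.isHorizontal ≠ s.isHorizontal) :
    ∃ w, (c w).1 = s ∧ Holds h v c x w (t + (2 / v + h)) := by
  obtain ⟨t', h1, h2, h3⟩ := (c u).exists_crossing hv s hp t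
  obtain ⟨w, hw, hn⟩ := exists_neighboursOn u h3 hs
  have hne : (c u).1 ≠ (c w).1 := fun e => hp (by rw [e, hw])
  refine ⟨w, hw, .carry w (t' + h) _ (.turn u w t' (.carry u t t' hu h1) hne ?_) (by linarith)⟩
  right
  rw [hw]
  exact hn

/-- A vehicle receives the packet while it crosses a street all of whose vehicles hold it. -/
theorem holds_of_full_perp (hv : 0 < v) {y : Fin k} {s : Street} {t : ℝ}
    (hs : ∃ i, (c i).1 = s) (hp : (c y).1.isHorizontal ≠ s.isHorizontal)
    (hfull : ∀ i, (c i).1 = s → Holds h v c x i t) :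
    Holds h v c x y (t + (2 / v + h)) := by
  obtain ⟨t', h1, h2, h3⟩ := (c y).exists_crossing hv s hp t
  obtain ⟨w, hw, hn⟩ := exists_neighboursOn y h3 hs
  have hne : (c w).1 ≠ (c y).1 := fun e => hp (by rw [← e, hw])
  refine .carry y (t' + h) _ (.turn w y t' (.carry w t t' (hfull w hw) h1) hne ?_) (by linarith)
  left
  rw [hw]
  exact hn.symm

/-- One cycle reaches a new vehicle of a street on which some but not all vehicles hold. -/
theorem exists_new_holder {s : Street} {m : ℕ} {u w : Fin k} (hus : (c u).1 = s)
    (hws : (c w).1 = s) (hu : Holds h v c x u (m * h)) (hw : ¬ Holds h v c x w (m * h)) :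
    ∃ w', (c w').1 = s ∧ ¬ Holds h v c x w' (m * h) ∧ Holds h v c x w' ((m + 1) * h) := by
  classical
  -- In a closest pair (holder, non-holder) the two are neighbours: a vehicle strictly between,
  -- holder or not, would form a closer such pair with one of them.
  let P : Finset (Fin k × Fin k) := Finset.univ.filter fun q =>
    ((c q.1).1 = s ∧ Holds h v c x q.1 (m * h)) ∧ ((c q.2).1 = s ∧ ¬ Holds h v c x q.2 (m * h))
  obtain ⟨⟨u', w'⟩, hq, hmin⟩ := Finset.exists_min_image P
    (fun q => dist ((c q.1).pos v (m * h)) ((c q.2).pos v (m * h)))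
    ⟨(u, w), by simp [P, hus, hws, hu, hw]⟩
  simp only [P, Finset.mem_filter, Finset.mem_univ, true_and, Prod.forall, and_imp] at hq hmin
  obtain ⟨⟨hu1, hu2⟩, hw1, hw2⟩ := hq
  refine ⟨w', hw1, hw2, .hop u' w' m hu2 (hu1.trans hw1.symm)
    ⟨(c u').pos_mem_segment v _, ?_, fun j hj hb => ?_⟩⟩
  · rw [hu1, ← hw1]; exact (c w').pos_mem_segment v _
  · by_cases hjh : Holds h v c x j (m * h)
    · have := hmin j w' (hj.trans hu1) hjh hw1 hw2
      have h2 := dist_lt_of_sbtw hb.symm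
      rw [dist_comm, dist_comm ((c w').pos v _)] at h2
      linarith
    · have := hmin u' j hu1 hu2 (hj.trans hu1) hjh
      have h2 := dist_lt_of_sbtw hb
      linarith

/-- The number of vehicles on a street. -/
noncomputable def streetCount (c : Fin k → Vehicle) (s : Street) : ℕ := {i : Fin k | (c i).1 = s}.ncard

theorem streetCount_le (s : Street) : streetCount c s ≤ k := by
  refine (Set.ncard_le_ncard (Set.subset_univ _)).trans ?_
  simp [Set.ncard_univ]

/-- A street with a holder is filled within as many cycles as it has vehicles. -/
theorem holds_of_streetCount (hh : 0 < h) {s : Street} {u : Fin k} (hus : (c u).1 = s) {t : ℝ}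
    (ht : 0 ≤ t) (hu : Holds h v c x u t) (w : Fin k) (hw : (c w).1 = s) :
    Holds h v c x w (t + h + streetCount c s * h) := by
  -- Hops start only at multiples of `h`; waiting for the next one accounts for the lone `+ h`.
  set m₀ := ⌈t / h⌉₊
  have l1 : t ≤ m₀ * h := (div_le_iff₀ hh).1 (Nat.le_ceil _)
  have l2 : (m₀ : ℝ) * h < t + h := by
    have := Nat.ceil_lt_add_one (div_nonneg ht hh.le)
    calc (m₀ : ℝ) * h < (t / h + 1) * h := by gcongr
      _ = t + h := by field_simp
  let A : ℕ → Set (Fin k) := fun j => {i | (c i).1 = s ∧ Holds h v c x i ((m₀ + j : ℕ) * h)}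
  have hA : ∀ j, u ∈ A j := fun j => ⟨hus, .carry u t _ hu (by push_cast; nlinarith)⟩
  have sub : ∀ j, A j ⊆ {i | (c i).1 = s} := fun j i hi => hi.1
  have mono : ∀ j, A j ⊆ A (j + 1) := fun j i hi =>
    ⟨hi.1, .carry i _ _ hi.2 (by push_cast; nlinarith)⟩
  -- Until the street is full, each cycle adds a holder. At `j = streetCount c s` the second
  -- alternative is impossible.
  have key : ∀ j, A j = {i | (c i).1 = s} ∨ j < (A j).ncard := by
    intro j
    induction j with
    | zero => exact .inr ((Set.ncard_pos (Set.toFinite _)).2 ⟨u, hA 0⟩)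
    | succ j ih =>
      rcases ih with ih | ih
      · exact .inl ((sub _).antisymm (ih ▸ mono j))
      · by_cases hf : A j = {i | (c i).1 = s}
        · exact .inl ((sub _).antisymm (hf ▸ mono j))
        · right
          obtain ⟨w', hw1, hw2⟩ := Set.exists_of_ssubset ((sub j).ssubset_of_ne hf)
          obtain ⟨w'', e1, e2, e3⟩ := exists_new_holder hus hw1 (hA j).2
            (fun H => hw2 ⟨hw1, H⟩)
          have : A j ⊂ A (j + 1) := by
            refine (Set.ssubset_iff_of_subset (mono j)).2 ⟨w'', ⟨e1, ?_⟩, fun H => e2 H.2⟩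
            convert e3 using 1
            push_cast; ring
          have := Set.ncard_lt_ncard this (Set.toFinite _)
          omega
  have hfull : A (streetCount c s) = {i | (c i).1 = s} := by
    rcases key (streetCount c s) with h | h
    · exact h
    · exact absurd (Set.ncard_le_ncard (sub (streetCount c s)) (Set.toFinite _)) (not_le.2 h)
  have : w ∈ A (streetCount c s) := hfull ▸ hw
  refine .carry w _ _ this.2 ?_
  push_cast
  linarith

/-- When both directions are populated, each populated street soon has a holder. -/
theorem exists_holder_on_street (hh : 0 < h) (hv : 0 < v)
    (hb : ∀ b, ∃ i, (c i).1.isHorizontal = b) {s : Street} (hs : ∃ i, (c i).1 = s) :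
    ∃ w, (c w).1 = s ∧ Holds h v c x w (2 * (2 / v + h)) := by
  have D : 0 < 2 / v + h := by positivity
  have hx : Holds h v c x x 0 := .source
  -- Parallel streets need a detour through a populated perpendicular street, hence the factor 2.
  by_cases hp : (c x).1.isHorizontal = s.isHorizontal
  · obtain ⟨i, hi⟩ := hb (!s.isHorizontal)
    obtain ⟨w, hw, hw'⟩ := exists_holds_perp hv hx ⟨i, rfl⟩
      (by rw [hi, hp]; cases s.isHorizontal <;> simp)
    obtain ⟨z, hz, hz'⟩ := exists_holds_perp hv hw' hs
      (by rw [hw, hi]; cases s.isHorizontal <;> simp)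
    exact ⟨z, hz, .carry z _ _ hz' (by linarith)⟩
  · obtain ⟨w, hw, hw'⟩ := exists_holds_perp hv hx hs hp
    exact ⟨w, hw, .carry w _ _ hw' (by linarith)⟩

/-- The number of vehicles on the street, replaced by the size of the population if there are
none. -/
noncomputable def fillCount (c : Fin k → Vehicle) (s : Street) : ℕ :=
  if streetCount c s = 0 then k else streetCount c s

/-- The packet reaches a vehicle after a time controlled by the occupation of any given
perpendicular street. -/
theorem holds_of_fillCount (hh : 0 < h) (hv : 0 < v)
    (hb : ∀ b, ∃ i, (c i).1.isHorizontal = b) (y : Fin k) {s : Street}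
    (hp : (c y).1.isHorizontal ≠ s.isHorizontal) :
    Holds h v c x y (3 * (2 / v + h) + h + fillCount c s * h) := by
  have D : 0 < 2 / v + h := by positivity
  unfold fillCount
  -- If `s` is empty, fill the street of `y` itself. Otherwise fill `s` and let `y` cross it, which
  -- adds the third `2 / v + h`.
  split_ifs with h0
  · obtain ⟨w, hw, hw'⟩ := exists_holder_on_street (x := x) hh hv hb (s := (c y).1) ⟨y, rfl⟩
    refine .carry y _ _ (holds_of_streetCount hh hw (by positivity) hw' y rfl) ?_
    have : (streetCount c (c y).1 : ℝ) ≤ k := by exact_mod_cast streetCount_le _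
    nlinarith
  · have hs : ∃ i, (c i).1 = s := Set.nonempty_of_ncard_ne_zero h0
    obtain ⟨w, hw, hw'⟩ := exists_holder_on_street (x := x) hh hv hb hs
    refine .carry y _ _ (holds_of_full_perp hv hs hp fun i hi =>
      holds_of_streetCount hh hw (by positivity) hw' i hi) ?_
    linarith

end Deterministic

/-! ### From single arrivals to the pair average. -/

/-- A street of the given orientation and level. -/
def cornerStreet (b : Bool) (l : ℕ) : Street := (b, ⟨l, ⟨0, by positivity⟩⟩)

/-- Each destination uses the corner street perpendicular to its own; adding both occupations gives
a bound uniform in the pair. -/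
theorem pairAverage_le {h v : ℝ} (hh : 0 < h) (hv : 0 < v) (l : ℕ) {Φ : Population}
    (hΦ : Φ ∈ bothDirections) :
    pairAverage h v Φ ≤ ENNReal.ofReal (3 * (2 / v + h) + h) + ENNReal.ofReal h *
      (fillCount Φ.2 (cornerStreet true l) + fillCount Φ.2 (cornerStreet false l)) := by
  obtain ⟨k, c⟩ := Φ
  have hb : ∀ b, ∃ i, (c i).1.isHorizontal = b := by
    intro b; cases b; exacts [hΦ.2, hΦ.1]
  set R := ENNReal.ofReal (3 * (2 / v + h) + h) + ENNReal.ofReal h *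
      (fillCount c (cornerStreet true l) + fillCount c (cornerStreet false l)) with hR
  have D : 0 < 2 / v + h := by positivity
  have key : ∀ x y, arrivalTime h v c x y ≤ R := by
    intro x y
    have H : ∀ b, (c y).1.isHorizontal ≠ b → arrivalTime h v c x y ≤
        ENNReal.ofReal (3 * (2 / v + h) + h) +
          ENNReal.ofReal h * fillCount c (cornerStreet b l) := by
      intro b hby
      have := holds_of_fillCount (x := x) hh hv hb y (s := cornerStreet b l) hby
      refine (iInf₂_le _ this).trans ?_
      rw [ENNReal.ofReal_add (by positivity) (by positivity),
        mul_comm (fillCount c _ : ℝ) h, ENNReal.ofReal_mul hh.le, ENNReal.ofReal_natCast]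
    cases hy : (c y).1.isHorizontal
    · refine (H true (by simp [hy])).trans ?_
      rw [hR]; gcongr; exact le_self_add
    · refine (H false (by simp [hy])).trans ?_
      rw [hR]; gcongr; exact le_add_self
  unfold pairAverage
  refine ENNReal.div_le_of_le_mul ?_
  calc ∑ x, ∑ y, arrivalTime h v c x y ≤ ∑ _x : Fin k, ∑ _y : Fin k, R :=
        Finset.sum_le_sum fun x _ => Finset.sum_le_sum fun y _ => key x y
    _ = R * (k : ℝ≥0∞) ^ 2 := by simp; ring


/-! ### The law of one vehicle -/

/-- A family of `k` vehicles as a population. -/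
def toPopulation (k : ℕ) (c : Fin k → Vehicle) : Population := ⟨k, c⟩

theorem measurableSet_sigma {α : Type*} {β : α → Type*} [∀ a, MeasurableSpace (β a)]
    {S : Set (Sigma β)} : MeasurableSet S ↔ ∀ a, MeasurableSet (Sigma.mk a ⁻¹' S) :=
  MeasurableSpace.measurableSet_iInf

theorem measurable_toPopulation (k : ℕ) : Measurable (toPopulation k) :=
  fun _ hS => measurableSet_sigma.1 hS k

instance : DiscreteMeasurableSpace (Σ l : ℕ, Fin (2 ^ l)) :=
  ⟨fun _ => measurableSet_sigma.2 fun _ => MeasurableSet.of_discrete⟩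

/-- The `2 ^ l` streets of level `l` together weigh `(p / 2) q ^ l`, a geometric series. -/
theorem tsum_streetWeight {p : ℝ} (hp0 : 0 < p) (hp1 : p < 1) (b : Bool) :
    ∑' x : Σ l : ℕ, Fin (2 ^ l),
      ENNReal.ofReal (p / 2 * ((1 - p) / 2) ^ Street.level (b, x)) = 2⁻¹ := by
  have q0 : 0 ≤ 1 - p := by linarith
  rw [ENNReal.tsum_sigma']
  have e : ∀ l : ℕ, ∑' j : Fin (2 ^ l),
      ENNReal.ofReal (p / 2 * ((1 - p) / 2) ^ Street.level (b, (⟨l, j⟩ : Σ l : ℕ, Fin (2 ^ l)))) =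
      ENNReal.ofReal (p / 2) * ENNReal.ofReal (1 - p) ^ l := by
    intro l
    simp only [Street.level, tsum_fintype, Finset.sum_const, Finset.card_univ, Fintype.card_fin,
      nsmul_eq_mul]
    rw [← ENNReal.ofReal_natCast, ← ENNReal.ofReal_pow q0, ← ENNReal.ofReal_mul (by positivity),
      ← ENNReal.ofReal_mul (by positivity)]
    congr 1
    push_cast
    rw [div_pow]
    field_simp
  rw [tsum_congr e, ENNReal.tsum_mul_left, ENNReal.tsum_geometric, ← ENNReal.ofReal_one,
    ← ENNReal.ofReal_sub _ q0, sub_sub_cancel, ← ENNReal.ofReal_inv_of_pos hp0,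
    ← ENNReal.ofReal_mul (by positivity), show p / 2 * p⁻¹ = 2⁻¹ by field_simp,
    ENNReal.ofReal_inv_of_pos two_pos, ENNReal.ofReal_ofNat]

theorem streetLaw_isHorizontal {p : ℝ} (hp0 : 0 < p) (hp1 : p < 1) (b : Bool) :
    streetLaw p {s | s.isHorizontal = b} = 2⁻¹ := by
  have hm : MeasurableSet {s : Street | s.isHorizontal = b} :=
    measurable_fst (measurableSet_singleton b)
  rw [streetLaw, Measure.sum_apply _ hm, ENNReal.summable.tsum_prod' fun _ => ENNReal.summable, tsum_bool]
  simp only [Measure.smul_apply, Measure.dirac_apply' _ hm, smul_eq_mul]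
  cases b <;> simp [Street.isHorizontal, Set.indicator, tsum_streetWeight hp0 hp1]

theorem streetLaw_singleton (p : ℝ) (s : Street) :
    streetLaw p {s} = ENNReal.ofReal (p / 2 * ((1 - p) / 2) ^ s.level) := by
  rw [streetLaw, Measure.sum_apply _ (measurableSet_singleton s), tsum_eq_single s]
  · simp
  · intro s' hs'
    simp [hs']

theorem isProbabilityMeasure_streetLaw {p : ℝ} (hp0 : 0 < p) (hp1 : p < 1) :
    IsProbabilityMeasure (streetLaw p) := by
  constructor
  have : (Set.univ : Set Street) = {s | s.isHorizontal = true} ∪ {s | s.isHorizontal = false} := by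
    ext s; simp
  rw [this, measure_union, streetLaw_isHorizontal hp0 hp1, streetLaw_isHorizontal hp0 hp1,
    ENNReal.inv_two_add_inv_two]
  · rw [Set.disjoint_left]; intro s h; simp_all
  · exact measurable_fst (measurableSet_singleton false)

theorem isProbabilityMeasure_volume_Icc :
    IsProbabilityMeasure (volume.restrict (Set.Icc (0 : ℝ) 1)) := ⟨by simp⟩

theorem isProbabilityMeasure_vehicleLaw {p : ℝ} (hp0 : 0 < p) (hp1 : p < 1) :
    IsProbabilityMeasure (vehicleLaw p) := by
  have := isProbabilityMeasure_streetLaw hp0 hp1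
  have := isProbabilityMeasure_volume_Icc
  unfold vehicleLaw
  infer_instance

theorem vehicleLaw_fst (p : ℝ) (S : Set Street) :
    vehicleLaw p {c | c.1 ∈ S} = streetLaw p S := by
  have := isProbabilityMeasure_volume_Icc
  have e : {c : Vehicle | c.1 ∈ S} = S ×ˢ Set.univ := by ext; simp
  rw [e, vehicleLaw, Measure.prod_prod, measure_univ, mul_one]

/-! ### Occupation of a street -/

theorem measurableSet_on_street {k : ℕ} (i : Fin k) (s : Street) :
    MeasurableSet {c : Fin k → Vehicle | (c i).1 = s} :=
  ((measurable_fst.comp (measurable_pi_apply i)) (measurableSet_singleton s))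

/-- Made for integration: the emptiness event is a product box, so its probability is a power. -/
theorem fillCount_eq {k : ℕ} (c : Fin k → Vehicle) (s : Street) :
    (fillCount c s : ℝ≥0∞) = ∑ i, {c : Fin k → Vehicle | (c i).1 = s}.indicator 1 c +
      k * (Set.univ.pi fun _ : Fin k => {a : Vehicle | a.1 ≠ s}).indicator 1 c := by
  classical
  unfold fillCount
  split_ifs with h0
  · have : {i : Fin k | (c i).1 = s} = ∅ := (Set.ncard_eq_zero (Set.toFinite _)).1 h0
    have hc : c ∈ Set.univ.pi fun _ : Fin k => {a : Vehicle | a.1 ≠ s} := by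
      intro i _ hi
      exact (Set.eq_empty_iff_forall_notMem.1 this i) hi
    have hz : ∀ i ∈ Finset.univ, {c : Fin k → Vehicle | (c i).1 = s}.indicator
        (1 : (Fin k → Vehicle) → ℝ≥0∞) c = 0 :=
      fun i _ => by rw [Set.indicator_of_notMem]; exact hc i trivial
    rw [Set.indicator_of_mem hc, Finset.sum_eq_zero hz]
    simp
  · obtain ⟨i, hi⟩ := Set.nonempty_of_ncard_ne_zero h0
    have hc : c ∉ Set.univ.pi fun _ : Fin k => {a : Vehicle | a.1 ≠ s} :=
      fun H => H i trivial hi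
    rw [Set.indicator_of_notMem hc, mul_zero, add_zero, streetCount, Set.ncard_eq_toFinset_card']
    simp [Set.indicator, Finset.sum_boole]

theorem measurableSet_empty_street (k : ℕ) (s : Street) :
    MeasurableSet (Set.univ.pi fun _ : Fin k => {a : Vehicle | a.1 ≠ s}) :=
  MeasurableSet.univ_pi fun _ => (measurable_fst (measurableSet_singleton s)).compl

theorem measurable_fillCount (k : ℕ) (s : Street) :
    Measurable fun c : Fin k → Vehicle => (fillCount c s : ℝ≥0∞) := by
  simp only [fillCount_eq]
  exact (Finset.measurable_sum _ fun i _ =>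
    measurable_one.indicator (measurableSet_on_street i s)).add
    ((measurable_one.indicator (measurableSet_empty_street k s)).const_mul _)

theorem lintegral_fillCount_le {p : ℝ} (hp0 : 0 < p) (hp1 : p < 1) (k : ℕ) (s : Street) {w : ℝ}
    (hw : w = p / 2 * ((1 - p) / 2) ^ s.level) :
    ∫⁻ c, (fillCount c s : ℝ≥0∞) ∂(Measure.pi fun _ : Fin k => vehicleLaw p) ≤
      ENNReal.ofReal (k * w + k * (1 - w) ^ k) := by
  have := isProbabilityMeasure_vehicleLaw hp0 hp1
  have w0 : 0 ≤ w := by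
    have : 0 ≤ 1 - p := by linarith
    rw [hw]; positivity
  have hw' : vehicleLaw p {a | a.1 = s} = ENNReal.ofReal w := by
    rw [hw, ← streetLaw_singleton]; exact vehicleLaw_fst p {s}
  have hmeas : MeasurableSet {a : Vehicle | a.1 = s} :=
    measurable_fst (measurableSet_singleton s)
  have w1 : w ≤ 1 := by
    rw [← ENNReal.ofReal_le_one, ← hw']; exact prob_le_one
  have hwc : vehicleLaw p {a | a.1 ≠ s} = ENNReal.ofReal (1 - w) := by
    have : {a : Vehicle | a.1 ≠ s} = {a | a.1 = s}ᶜ := rfl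
    rw [this, prob_compl_eq_one_sub hmeas, hw', ENNReal.ofReal_sub _ w0, ENNReal.ofReal_one]
  have hbox := measurableSet_empty_street k s
  simp only [fillCount_eq]
  rw [lintegral_add_right _ ((measurable_one.indicator hbox).const_mul _),
    lintegral_finsetSum _ fun i _ => measurable_one.indicator (measurableSet_on_street i s),
    lintegral_const_mul _ (measurable_one.indicator hbox), lintegral_indicator_one hbox,
    Measure.pi_pi]
  simp only [lintegral_indicator_one (measurableSet_on_street _ s), hwc, Finset.prod_const,
    Finset.card_univ, Fintype.card_fin]
  have hi : ∀ i : Fin k, (Measure.pi fun _ : Fin k => vehicleLaw p) {c | (c i).1 = s} =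
      ENNReal.ofReal w := fun i => by
    rw [← hw']
    exact (measurePreserving_eval (fun _ : Fin k => vehicleLaw p) i).measure_preimage
      hmeas.nullMeasurableSet
  have w2 : 0 ≤ 1 - w := by linarith
  rw [Finset.sum_congr rfl fun i _ => hi i, Finset.sum_const, Finset.card_univ, Fintype.card_fin,
    nsmul_eq_mul, ENNReal.ofReal_add (by positivity) (by positivity),
    ENNReal.ofReal_mul (by positivity), ENNReal.ofReal_mul (by positivity), ENNReal.ofReal_natCast,
    ENNReal.ofReal_pow w2]

/-! ### Populations on both directions -/

theorem measurableSet_isHorizontal {k : ℕ} (i : Fin k) (b : Bool) :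
    MeasurableSet {c : Fin k → Vehicle | (c i).1.isHorizontal = b} :=
  (measurable_fst.comp (measurable_fst.comp (measurable_pi_apply i))) (measurableSet_singleton b)

theorem measurableSet_bothDirections : MeasurableSet bothDirections := by
  refine measurableSet_sigma.2 fun k => ?_
  have e : toPopulation k ⁻¹' bothDirections =
      (⋃ i, {c | (c i).1.isHorizontal = true}) ∩ ⋃ i, {c | (c i).1.isHorizontal = false} := by
    ext c; simp [bothDirections, toPopulation]
  change MeasurableSet (toPopulation k ⁻¹' bothDirections)
  rw [e]
  exact (MeasurableSet.iUnion fun i => measurableSet_isHorizontal i _).inter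
    (MeasurableSet.iUnion fun i => measurableSet_isHorizontal i _)

theorem two_inv_le_fixedLaw_bothDirections {p : ℝ} (hp0 : 0 < p) (hp1 : p < 1) {k : ℕ}
    (hk : 2 ≤ k) : 2⁻¹ ≤ fixedLaw p k bothDirections := by
  have := isProbabilityMeasure_vehicleLaw hp0 hp1
  change _ ≤ (Measure.pi fun _ : Fin k => vehicleLaw p).map (toPopulation k) _
  rw [Measure.map_apply (measurable_toPopulation k) measurableSet_bothDirections]
  set μ := Measure.pi fun _ : Fin k => vehicleLaw p
  set S : Set (Fin k → Vehicle) := toPopulation k ⁻¹' bothDirections with hS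
  have hSm : MeasurableSet S := measurable_toPopulation k measurableSet_bothDirections
  -- Failure means that all vehicles share one orientation, of probability at most `2 * 2⁻¹ ^ k ≤
  -- 2⁻¹` for `k ≥ 2`.
  let B : Bool → Set (Fin k → Vehicle) := fun b =>
    Set.univ.pi fun _ => {a : Vehicle | a.1 ∈ {s : Street | s.isHorizontal = b}}
  have hB : ∀ b, μ (B b) = 2⁻¹ ^ k := fun b => by
    simp only [B, μ, Measure.pi_pi, vehicleLaw_fst, streetLaw_isHorizontal hp0 hp1]
    simp
  have sub : Sᶜ ⊆ B true ∪ B false := by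
    intro c hc
    simp only [hS, toPopulation, bothDirections, Set.mem_compl_iff, Set.mem_preimage, Set.mem_ofPred_eq,
      not_and_or, not_exists] at hc
    rcases hc with hc | hc
    · right; intro i _; simpa using hc i
    · left; intro i _; simpa using hc i
  have hc : μ Sᶜ ≤ 2⁻¹ := by
    calc μ Sᶜ ≤ 2⁻¹ ^ k + 2⁻¹ ^ k := by
          refine (measure_mono sub).trans ((measure_union_le _ _).trans ?_)
          rw [hB, hB]
      _ ≤ 2⁻¹ ^ 2 + 2⁻¹ ^ 2 := by
          have h1 : (2⁻¹ : ℝ≥0∞) ≤ 1 := ENNReal.inv_le_one.2 one_le_two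
          exact add_le_add (pow_le_pow_right_of_le_one' h1 hk) (pow_le_pow_right_of_le_one' h1 hk)
      _ = 2⁻¹ := by
          rw [pow_two, ← mul_add, ENNReal.inv_two_add_inv_two, mul_one]
  have h1 : μ S + μ Sᶜ = 1 := by rw [measure_add_measure_compl hSm, measure_univ]
  have h2 : (2⁻¹ : ℝ≥0∞) + 2⁻¹ ≤ μ S + 2⁻¹ := by
    rw [ENNReal.inv_two_add_inv_two, ← h1]; gcongr
  exact (ENNReal.add_le_add_iff_right (by simp)).1 h2

theorem poissonMeasure_lt_two (n : ℕ) (hn : 3 ≤ n) :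
    poissonMeasure (n : ℝ≥0) {0, 1} ≤ 2⁻¹ := by
  have hn' : (3 : ℝ) ≤ n := by exact_mod_cast hn
  have e : ({0, 1} : Set ℕ) = {0} ∪ {1} := rfl
  rw [e]
  refine (measure_union_le _ _).trans ?_
  rw [poissonMeasure_singleton, poissonMeasure_singleton, ← ENNReal.ofReal_add (by positivity)
    (by positivity), ← ENNReal.ofReal_ofNat, ← ENNReal.ofReal_inv_of_pos two_pos]
  refine ENNReal.ofReal_le_ofReal ?_
  -- The claim `2 (1 + n) ≤ exp n` follows from `1 + n + n² / 2 ≤ exp n` once `n ≥ 3`.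
  have hq := Real.quadratic_le_exp_of_nonneg (x := (n : ℝ)) (by positivity)
  simp only [NNReal.coe_natCast, pow_zero, Nat.factorial_zero, Nat.factorial_one, Nat.cast_one,
    pow_one, Real.exp_neg]
  rw [div_one, div_one, mul_one, ← mul_one_add, inv_mul_le_iff₀ (Real.exp_pos _)]
  nlinarith

/-- At least two vehicles are present with probability at least 1/2, and then both orientations
occur with probability at least 1/2. -/
theorem four_inv_le_poissonLaw_bothDirections {p : ℝ} (hp0 : 0 < p) (hp1 : p < 1) {n : ℕ}
    (hn : 3 ≤ n) : 4⁻¹ ≤ poissonLaw p n bothDirections := by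
  have h4 : (4⁻¹ : ℝ≥0∞) = 2⁻¹ * 2⁻¹ := by
    rw [← ENNReal.mul_inv (by simp) (by simp)]; norm_num
  have hc : 2⁻¹ ≤ poissonMeasure (n : ℝ≥0) {0, 1}ᶜ := by
    have h1 : poissonMeasure (n : ℝ≥0) {0, 1}ᶜ + poissonMeasure (n : ℝ≥0) {0, 1} = 1 := by
      rw [add_comm, measure_add_measure_compl (MeasurableSet.of_discrete), measure_univ]
    have h2 : (2⁻¹ : ℝ≥0∞) + 2⁻¹ ≤ poissonMeasure (n : ℝ≥0) {0, 1}ᶜ + 2⁻¹ := by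
      rw [ENNReal.inv_two_add_inv_two, ← h1]
      gcongr
      exact poissonMeasure_lt_two n hn
    exact (ENNReal.add_le_add_iff_right (by simp)).1 h2
  rw [poissonLaw, Measure.sum_apply _ measurableSet_bothDirections, h4]
  calc (2⁻¹ : ℝ≥0∞) * 2⁻¹ ≤ poissonMeasure (n : ℝ≥0) {0, 1}ᶜ * 2⁻¹ := by gcongr
    _ = ∑' k, ({0, 1}ᶜ : Set ℕ).indicator (fun k => poissonMeasure (n : ℝ≥0) {k}) k * 2⁻¹ := by
        rw [ENNReal.tsum_mul_right, Measure.tsum_indicator_apply_singleton _ _ .of_discrete]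
    _ ≤ _ := by
        refine ENNReal.tsum_le_tsum fun k => ?_
        by_cases hk : k ∈ ({0, 1}ᶜ : Set ℕ)
        · rw [Set.indicator_of_mem hk, Measure.smul_apply, smul_eq_mul]
          gcongr
          refine two_inv_le_fixedLaw_bothDirections hp0 hp1 ?_
          simp at hk
          omega
        · rw [Set.indicator_of_notMem hk]; simp

theorem broadcastTime_le_four_mul {h v : ℝ} {P : Measure Population}
    (hP : 4⁻¹ ≤ P bothDirections) :
    broadcastTime h v P ≤ 4 * ∫⁻ Φ in bothDirections, pairAverage h v Φ ∂P := by
  rw [broadcastTime, ProbabilityTheory.cond, lintegral_smul_measure, smul_eq_mul]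
  gcongr
  exact ENNReal.inv_le_iff_inv_le.1 hP

/-! ### Choice of a level with logarithmically many vehicles -/

theorem mul_one_sub_pow_le {w : ℝ} (hw1 : w ≤ 1) (k : ℕ) :
    k * (1 - w) ^ k ≤ k * Real.exp (-(k * w)) := by
  have := Real.one_sub_le_exp_neg w
  calc (k : ℝ) * (1 - w) ^ k ≤ k * Real.exp (-w) ^ k := by gcongr
    _ = _ := by rw [← Real.exp_nat_mul]; ring_nf

theorem exists_level {p : ℝ} (hp0 : 0 < p) (hp1 : p < 1) (k : ℕ) :
    ∃ l : ℕ, k * (p / 2 * ((1 - p) / 2) ^ l) ≤ 2 / (1 - p) * (1 + Real.log k) ∧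
      k * (1 - p / 2 * ((1 - p) / 2) ^ l) ^ k ≤ 1 + 2 / p := by
  have q0 : 0 < 1 - p := by linarith
  have hL : 0 ≤ Real.log k := Real.log_natCast_nonneg k
  set w : ℕ → ℝ := fun l => p / 2 * ((1 - p) / 2) ^ l with hw
  have w1 : ∀ l, w l ≤ 1 := fun l => by
    have : ((1 - p) / 2) ^ l ≤ 1 := pow_le_one₀ (by positivity) (by linarith)
    have h0 : 0 ≤ ((1 - p) / 2) ^ l := by positivity
    simp only [hw]; nlinarith
  have hr : 1 ≤ 2 / (1 - p) := by rw [le_div_iff₀ q0]; linarith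
  have p2 : 0 < 2 / p := by positivity
  -- If even level 0 is sparse, take it: `k` is `2 / p` times `k * w 0`, and `x * exp (-x) ≤ 1`.
  -- Otherwise take the last level before the mean first drops below `1 + log k`; consecutive means
  -- differ by the factor `2 / (1 - p)`.
  by_cases h0 : k * w 0 < 1 + Real.log k
  · refine ⟨0, h0.le.trans (by nlinarith), (mul_one_sub_pow_le (w1 0) k).trans ?_⟩
    have hx : (k : ℝ) * w 0 * Real.exp (-(k * w 0)) ≤ 1 := by
      have := Real.add_one_le_exp (k * w 0)
      rw [Real.exp_neg, ← div_eq_mul_inv, div_le_one (Real.exp_pos _)]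
      linarith
    have e : (k : ℝ) * Real.exp (-(k * w 0)) = 2 / p * (k * w 0 * Real.exp (-(k * w 0))) := by
      simp only [hw, pow_zero]; field_simp
    rw [e]; nlinarith
  · have hex : ∃ l, k * w l < 1 + Real.log k := by
      have : Tendsto (fun l => k * w l) atTop (nhds (k * (p / 2 * 0))) :=
        ((tendsto_pow_atTop_nhds_zero_of_lt_one (by linarith) (by linarith)).const_mul
          _).const_mul _
      exact (this.eventually_lt_const (by simp; linarith)).exists
    classical
    set m := Nat.find hex with hm
    have hm1 : k * w m < 1 + Real.log k := Nat.find_spec hex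
    have hm0 : m ≠ 0 := fun e => h0 (e ▸ hm1)
    obtain ⟨l, hl⟩ := Nat.exists_eq_succ_of_ne_zero hm0
    have hl1 : 1 + Real.log k ≤ k * w l := not_lt.1 (Nat.find_min hex (by omega))
    refine ⟨l, ?_, (mul_one_sub_pow_le (w1 l) k).trans ?_⟩
    · have e : k * w l = 2 / (1 - p) * (k * w m) := by
        simp only [hw, hl, pow_succ]; field_simp
      change k * w l ≤ _
      rw [e]; gcongr
    · change (k : ℝ) * Real.exp (-(k * w l)) ≤ _
      rcases Nat.eq_zero_or_pos k with rfl | hk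
      · simp; linarith
      · have hk' : (0 : ℝ) < k := by exact_mod_cast hk
        have : Real.exp (-(k * w l)) ≤ Real.exp (-Real.log k) := Real.exp_le_exp.2 (by linarith)
        rw [Real.exp_neg (Real.log k), Real.exp_log hk'] at this
        calc (k : ℝ) * Real.exp (-(k * w l)) ≤ k * (k : ℝ)⁻¹ := by gcongr
          _ = 1 := mul_inv_cancel₀ hk'.ne'
          _ ≤ _ := by linarith

/-! ### Expected broadcast times -/

/-- The constants serve all `k` at once, including `k = 0` where `Real.log 0 = 0`, as the Poisson
mixture requires. -/
theorem setLIntegral_pairAverage_fixedLaw_le {p h v : ℝ} (hp0 : 0 < p) (hp1 : p < 1) (hh : 0 < h)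
    (hv : 0 < v) : ∃ A B : ℝ, 0 ≤ A ∧ 0 ≤ B ∧ ∀ k : ℕ,
      ∫⁻ Φ in bothDirections, pairAverage h v Φ ∂(fixedLaw p k) ≤
        ENNReal.ofReal (A + B * Real.log k) := by
  have q0 : 0 < 1 - p := by linarith
  refine ⟨3 * (2 / v + h) + h + 2 * h * (2 / (1 - p) + (1 + 2 / p)), 2 * h * (2 / (1 - p)),
    by positivity, by positivity, fun k => ?_⟩
  have := isProbabilityMeasure_vehicleLaw hp0 hp1
  obtain ⟨l, hl1, hl2⟩ := exists_level hp0 hp1 k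
  set M := 2 / (1 - p) * (1 + Real.log k) + (1 + 2 / p) with hM
  have hLk : 0 ≤ Real.log k := Real.log_natCast_nonneg k
  have hM0 : 0 ≤ M := by positivity
  have hfill : ∀ b, ∫⁻ c, (fillCount c (cornerStreet b l) : ℝ≥0∞)
      ∂(Measure.pi fun _ : Fin k => vehicleLaw p) ≤ ENNReal.ofReal M := fun b =>
    (lintegral_fillCount_le hp0 hp1 k (cornerStreet b l) rfl).trans
      (ENNReal.ofReal_le_ofReal (add_le_add hl1 hl2))
  rw [← lintegral_indicator measurableSet_bothDirections]
  change ∫⁻ Φ, _ ∂(Measure.pi fun _ : Fin k => vehicleLaw p).map (toPopulation k) ≤ _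
  -- This inequality holds for any integrand, so measurability of `pairAverage` is never needed.
  refine (lintegral_map_le _ _).trans ?_
  calc _ ≤ ∫⁻ c, (ENNReal.ofReal (3 * (2 / v + h) + h) + ENNReal.ofReal h *
          (fillCount c (cornerStreet true l) + fillCount c (cornerStreet false l)))
          ∂(Measure.pi fun _ : Fin k => vehicleLaw p) := by
        refine lintegral_mono fun c => ?_
        by_cases hc : toPopulation k c ∈ bothDirections
        · rw [Set.indicator_of_mem hc]
          exact pairAverage_le hh hv l hc
        · rw [Set.indicator_of_notMem hc]
          exact zero_le
    _ ≤ ENNReal.ofReal (3 * (2 / v + h) + h) +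
          ENNReal.ofReal h * (ENNReal.ofReal M + ENNReal.ofReal M) := by
        rw [lintegral_add_left measurable_const, lintegral_const, measure_univ, mul_one,
          lintegral_const_mul' _ _ ENNReal.ofReal_ne_top,
          lintegral_add_left (measurable_fillCount k _)]
        gcongr <;> exact hfill _
    _ = _ := by
        rw [← ENNReal.ofReal_add hM0 hM0, ← ENNReal.ofReal_mul hh.le,
          ← ENNReal.ofReal_add (by positivity) (by positivity)]
        congr 1
        rw [hM]; ring

theorem tsum_poissonMeasure_singleton (r : ℝ≥0) : ∑' k : ℕ, poissonMeasure r {k} = 1 := by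
  have := Measure.tsum_indicator_apply_singleton (poissonMeasure r) Set.univ MeasurableSet.univ
  simpa using this

/-- Mean of the Poisson law, by the shift `(k + 1) P(k + 1) = n P(k)`. -/
theorem tsum_poissonMeasure_mul (n : ℕ) :
    ∑' k : ℕ, poissonMeasure (n : ℝ≥0) {k} * k = n := by
  rw [tsum_eq_zero_add' ENNReal.summable]
  have e : ∀ k : ℕ, poissonMeasure (n : ℝ≥0) {k + 1} * ((k + 1 : ℕ) : ℝ≥0∞) =
      n * poissonMeasure (n : ℝ≥0) {k} := fun k => by
    rw [poissonMeasure_singleton, poissonMeasure_singleton, ← ENNReal.ofReal_natCast,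
      ← ENNReal.ofReal_natCast, ← ENNReal.ofReal_mul (by positivity),
      ← ENNReal.ofReal_mul (by positivity)]
    congr 1
    rw [Nat.factorial_succ, pow_succ]
    push_cast
    field_simp
  rw [tsum_congr e, ENNReal.tsum_mul_left, tsum_poissonMeasure_singleton]
  simp

/-- A tangent bound for `log` at `n`, linear in `k`, so that only the Poisson mean enters the
average of `log k`. -/
theorem log_le_log_add_div {n : ℕ} (hn : 1 ≤ n) (k : ℕ) :
    Real.log k ≤ Real.log n + k / n := by
  have hn' : (0 : ℝ) < n := by exact_mod_cast hn
  rcases Nat.eq_zero_or_pos k with rfl | hk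
  · simpa using Real.log_natCast_nonneg n
  · have hk' : (0 : ℝ) < k := by exact_mod_cast hk
    have := Real.log_le_sub_one_of_pos (div_pos hk' hn')
    rw [Real.log_div hk'.ne' hn'.ne'] at this
    linarith

theorem delta_le_one {p : ℝ} (hp0 : 0 < p) (hp1 : p < 1) : delta p ≤ 1 := by
  have q0 : 0 < 1 - p := by linarith
  have h2 : 0 < Real.log 2 := Real.log_pos one_lt_two
  have : 2 ≤ fractalDim p := by
    rw [fractalDim, le_div_iff₀ h2, ← Real.log_rpow two_pos]
    refine Real.log_le_log (by positivity) ?_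
    rw [le_div_iff₀ q0]
    norm_num
    linarith
  rw [delta, div_le_one (by linarith)]
  linarith

theorem setLIntegral_poissonLaw_le {p A B : ℝ} (hA : 0 ≤ A) (hB : 0 ≤ B)
    {f : Population → ℝ≥0∞} {S : Set Population} (hS : MeasurableSet S)
    (hf : ∀ k : ℕ, ∫⁻ Φ in S, f Φ ∂(fixedLaw p k) ≤ ENNReal.ofReal (A + B * Real.log k))
    {n : ℕ} (hn : 1 ≤ n) :
    ∫⁻ Φ in S, f Φ ∂(poissonLaw p n) ≤ ENNReal.ofReal (A + B + B * Real.log n) := by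
  have hn' : (0 : ℝ) < n := by exact_mod_cast hn
  have hL : 0 ≤ Real.log n := Real.log_natCast_nonneg n
  rw [← lintegral_indicator hS, poissonLaw, lintegral_sum_measure]
  calc _ ≤ ∑' k : ℕ, (poissonMeasure (n : ℝ≥0) {k} * ENNReal.ofReal (A + B * Real.log n) +
          poissonMeasure (n : ℝ≥0) {k} * k * ENNReal.ofReal (B / n)) := by
        refine ENNReal.tsum_le_tsum fun k => ?_
        rw [lintegral_smul_measure, smul_eq_mul, lintegral_indicator hS, mul_assoc, ← mul_add]
        gcongr
        refine (hf k).trans ?_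
        rw [← ENNReal.ofReal_natCast k, ← ENNReal.ofReal_mul (by positivity),
          ← ENNReal.ofReal_add (by positivity) (by positivity)]
        refine ENNReal.ofReal_le_ofReal ?_
        have := mul_le_mul_of_nonneg_left (log_le_log_add_div hn k) hB
        have e : (k : ℝ) * (B / n) = B * (k / n) := by ring
        rw [e]; linarith
    _ = _ := by
        rw [ENNReal.tsum_add, ENNReal.tsum_mul_right, ENNReal.tsum_mul_right,
          tsum_poissonMeasure_singleton, tsum_poissonMeasure_mul, one_mul,
          ← ENNReal.ofReal_natCast n, ← ENNReal.ofReal_mul (by positivity),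
          ← ENNReal.ofReal_add (by positivity) (by positivity)]
        congr 1
        field_simp
        ring

/-- A logarithmic bound on the broadcast time implies the power bound. -/
theorem four_mul_ofReal_log_le {p A B : ℝ} (hp0 : 0 < p) (hp1 : p < 1) (hA : 0 ≤ A)
    (hB : 0 ≤ B) {n : ℕ} (hn : 3 ≤ n) : 4 * ENNReal.ofReal (A + B * Real.log n) ≤
      ENNReal.ofReal (4 * (A + B) * ((n : ℝ) ^ (1 - delta p) * Real.log n)) := by
  have hn' : (3 : ℝ) ≤ n := by exact_mod_cast hn
  -- As `n ≥ 3 > e`, the constant `A` is absorbed into `A * log n`.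
  have h1 : 1 ≤ Real.log n := by
    rw [Real.le_log_iff_exp_le (by linarith)]
    linarith [Real.exp_one_lt_d9]
  have h2 : 1 ≤ (n : ℝ) ^ (1 - delta p) :=
    Real.one_le_rpow (by linarith) (by linarith [delta_le_one hp0 hp1])
  rw [← ENNReal.ofReal_ofNat, ← ENNReal.ofReal_mul (by norm_num)]
  refine ENNReal.ofReal_le_ofReal ?_
  have h3 : Real.log n ≤ (n : ℝ) ^ (1 - delta p) * Real.log n := by nlinarith
  have h4 : A ≤ A * Real.log n := by nlinarith
  calc 4 * (A + B * Real.log n) ≤ 4 * (A + B) * Real.log n := by linarith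
    _ ≤ _ := by gcongr

end Hyperfractal

open Hyperfractal

theorem corollary1 (p h v : ℝ) (hp0 : 0 < p) (hp1 : p < 1) (hh : 0 < h) (hv : 0 < v) :
    (∃ C : ℝ, ∀ᶠ n : ℕ in atTop,
      Hyperfractal.broadcastTime h v (Hyperfractal.fixedLaw p n) ≤
        ENNReal.ofReal (C * ((n : ℝ) ^ (1 - Hyperfractal.delta p) * Real.log n))) ∧
    (∃ C : ℝ, ∀ᶠ n : ℕ in atTop,
      Hyperfractal.broadcastTime h v (Hyperfractal.poissonLaw p n) ≤
        ENNReal.ofReal (C * ((n : ℝ) ^ (1 - Hyperfractal.delta p) * Real.log n))) := by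
  obtain ⟨A, B, hA, hB, hAB⟩ := setLIntegral_pairAverage_fixedLaw_le hp0 hp1 hh hv
  refine ⟨⟨4 * (A + B), eventually_atTop.2 ⟨3, fun n hn => ?_⟩⟩,
    ⟨4 * (A + B + B), eventually_atTop.2 ⟨3, fun n hn => ?_⟩⟩⟩
  · have h4 : (4⁻¹ : ℝ≥0∞) ≤ fixedLaw p n bothDirections :=
      (ENNReal.inv_le_inv.2 (by norm_num)).trans
        (two_inv_le_fixedLaw_bothDirections hp0 hp1 (by omega))
    exact (broadcastTime_le_four_mul h4).trans
      ((mul_le_mul_right (hAB n) 4).trans (four_mul_ofReal_log_le hp0 hp1 hA hB hn))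
  · exact (broadcastTime_le_four_mul (four_inv_le_poissonLaw_bothDirections hp0 hp1 hn)).trans
      ((mul_le_mul_right (setLIntegral_poissonLaw_le hA hB measurableSet_bothDirections hAB
        (by omega)) 4).trans (four_mul_ofReal_log_le hp0 hp1 (by positivity) hB hn))
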